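/- Let $T$ be an arbitrary first-order theory (one-sorted, not assumed complete or dependent). All tuples of variables are finite, all natural numbers $k$ below are finite bounds, and sequences of finite tuples are indexed by infinite linear orders. Definitions. A sequence $(a_j)_{j\in J}$ of $m$-tuples is indiscernible over a set $B$ if any two of its strictly increasing finite subsequences of the same length have the same type over $B$. A family of sequences (whose tuple lengths and index orders may differ) is mutually indiscernible over $B$ if each sequence is indiscernible over $B$ together with all elements occurring in the other sequences. Let $M\models T$, $A\subseteq M$, and let $p(x)$ be a partial type over $A$ (a set of formulas with parameters in $A$, finitely satisfiable in $M$). We say that $p$ has dp-rank $\le k$ if, in every elementary extension of $M$, for every realization $a$ of $p$ and every $1+k$ infinite sequences that are mutually indiscernible over $A$, at least one of these sequences is indiscernible over $A\cup a$. The alternation rank $\mathrm{alt}(\varphi(x,y))\in\mathbb N\cup\{\infty\}$ of a formula is the supremum of all $l$ for which there are a model of $T$, a tuple $c$ in it and an infinite $\emptyset$-indiscernible sequence $(b_j)_{j\in J}$ in it with indices $j_0<\dots<j_l$ such that the truth values of $\varphi(c,b_{j_i})$ and $\varphi(c,b_{j_{i+1}})$ differ for all $i<l$. The theory $T$ is dp-minimal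 if all its complete one-variable types over $\emptyset$ have dp-rank $\le 1$. Corollaries. 1. Let $x$ be a finite tuple of variables and $k\in\mathbb N$. If every complete type $p(x)$ over $\emptyset$ has dp-rank $\le k$, then $\mathrm{alt}(\varphi(x,y))\le 2k+1$ for every formula $\varphi(x,y)$. 2. If every complete one-variable type over $\emptyset$ has finite dp-rank, then every complete type in finitely many variables over any set of parameters has finite dp-rank. 3. Let $k\in\mathbb N$. If every complete one-variable type over $\emptyset$ has dp-rank $\le k$, then every partial type $p(x)$ in finitely many variables, over any set of parameters, has dp-rank $\le |x|\cdot k$, and $\mathrm{alt}(\varphi(x,y))\le 2k|x|+1$ for every formula $\varphi(x,y)$. 4. In particular, if $T$ is dp-minimal, then $\mathrm{alt}(\varphi(x,y))\le 2|x|+1$ for every formula $\varphi(x,y)$. -/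

import Mathlib

open FirstOrder Set

universe u v w

namespace DpRank

section

variable {L : FirstOrder.Language.{u, v}} {M N : Type w} [L.Structure M] [L.Structure N]

/-- The sequence `(I j)_{j ∈ J}` of `m`-tuples of `N` is indiscernible over the set `B`: any two
strictly increasing finite subsequences of the same length have the same type over `B`. -/
def Indiscernible (L : FirstOrder.Language.{u, v}) {N : Type w} [L.Structure N] (B : Set N)
    {J : Type w} [LinearOrder J] {m : ℕ} (I : J → Fin m → N) : Prop :=
  ∀ (r : ℕ) (φ : L.Formula (B ⊕ (Fin r × Fin m))) (i i' : Fin r → J),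
    StrictMono i → StrictMono i' →
      (φ.Realize (Sum.elim (fun b : B => (b : N)) (fun q => I (i q.1) q.2)) ↔
        φ.Realize (Sum.elim (fun b : B => (b : N)) (fun q => I (i' q.1) q.2)))

/-- The set of all coordinates of all members of a sequence of tuples. -/
def entries {N J : Type w} {m : ℕ} (I : J → Fin m → N) : Set N :=
  {b | ∃ j t, I j t = b}

/-- The sequences `I s` (each a sequence of finite tuples, whose length `m s` and index order `J s`
may depend on `s`) are mutually indiscernible over `B`: each of them is indiscernible over `B`
together with all the others. -/
def MutuallyIndiscernible (L : FirstOrder.Language.{u, v}) {N : Type w} [L.Structure N] (B : Set N)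
    {S : Type} {J : S → Type w} [∀ s, LinearOrder (J s)] {m : S → ℕ}
    (I : ∀ s, J s → Fin (m s) → N) : Prop :=
  ∀ s, Indiscernible L (B ∪ ⋃ (t) (_ : t ≠ s), entries (I t)) (I s)

/-- A set of formulas `p(x)` with `x = (x_0, …, x_{n-1})` and parameters from `A ⊆ M` (the
parameters being substituted for the variables indexed by `A`) is realized by the tuple `a` in the
elementary extension `f : M → N`. -/
def Realizes (f : M ↪ₑ[L] N) {A : Set M} {n : ℕ} (p : Set (L.Formula (A ⊕ Fin n)))
    (a : Fin n → N) : Prop :=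
  ∀ φ ∈ p, φ.Realize (Sum.elim (fun c : A => f (c : M)) a)

/-- `p(x)` is a partial type over `A ⊆ M`: it is consistent, that is, finitely satisfiable
in `M`. -/
def IsPartialType {A : Set M} {n : ℕ} (p : Set (L.Formula (A ⊕ Fin n))) : Prop :=
  ∀ q : Finset (L.Formula (A ⊕ Fin n)), (q : Set (L.Formula (A ⊕ Fin n))) ⊆ p →
    ∃ a : Fin n → M, ∀ φ ∈ q, φ.Realize (Sum.elim (fun c : A => (c : M)) a)

/-- `p(x)` is a complete type over `A ⊆ M`. -/
def IsCompleteType {A : Set M} {n : ℕ} (p : Set (L.Formula (A ⊕ Fin n))) : Prop :=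
  IsPartialType p ∧ ∀ φ : L.Formula (A ⊕ Fin n), φ ∈ p ∨ φ.not ∈ p

/-- The dp-rank of `p(x)`, a type over `A ⊆ M`, is at most `k`: for every realization `a` of `p`
and all `1 + k` infinite sequences that are mutually indiscernible over `A`, at least one of these
sequences is indiscernible over `A ∪ a`. The realization and the sequences are taken in an
arbitrary elementary extension `N` of `M`. -/
def DpRankLE {A : Set M} {n : ℕ} (p : Set (L.Formula (A ⊕ Fin n))) (k : ℕ) : Prop :=
  ∀ (N : Type w) [L.Structure N] (f : M ↪ₑ[L] N) (a : Fin n → N), Realizes f p a →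
    ∀ (J : Fin (1 + k) → Type w) [∀ s, LinearOrder (J s)] [∀ s, Infinite (J s)]
      (m : Fin (1 + k) → ℕ) (I : ∀ s, J s → Fin (m s) → N),
      MutuallyIndiscernible L (f '' A) I → ∃ s, Indiscernible L (f '' A ∪ range a) (I s)

/-- The truth value of `φ(c, y)` changes (at least) `l` times along the sequence `I`. -/
def HasAlternations {J : Type w} [LinearOrder J] {n m : ℕ}
    (φ : L.Formula (Fin n ⊕ Fin m)) (c : Fin n → N) (I : J → Fin m → N) (l : ℕ) : Prop :=
  ∃ i : Fin (l + 1) → J, StrictMono i ∧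
    ∀ j : Fin l, ¬ (φ.Realize (Sum.elim c (I (i j.castSucc))) ↔
      φ.Realize (Sum.elim c (I (i j.succ))))

end

section

variable {L : FirstOrder.Language.{u, v}}

/-- The alternation rank `alt(φ(x,y)) ∈ ℕ ∪ {∞}` of a formula in the theory `T`: the supremum of
the `l` such that in some model of `T` there are a tuple `c` and an infinite sequence, indiscernible
over `∅`, along which the truth value of `φ(c, y)` alternates `l` times. -/
noncomputable def altRank (T : L.Theory) {n m : ℕ} (φ : L.Formula (Fin n ⊕ Fin m)) : ℕ∞ :=
  sSup {e : ℕ∞ | ∃ l : ℕ, e = l ∧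
    ∃ (N : FirstOrder.Language.Theory.ModelType.{u, v, max u v w} T) (J : Type (max u v w))
      (_ : LinearOrder J) (_ : Infinite J) (c : Fin n → N) (I : J → Fin m → N),
      Indiscernible L (∅ : Set N) I ∧ HasAlternations φ c I l}

/-- Every complete type over `∅` in `n` variables of the theory `T` has dp-rank at most `k`. -/
def TypesDpRankLE (T : L.Theory) (n k : ℕ) : Prop :=
  ∀ (M : FirstOrder.Language.Theory.ModelType.{u, v, max u v w} T)
    (p : Set (L.Formula ((∅ : Set M) ⊕ Fin n))), IsCompleteType p → DpRankLE p k

/-- A theory is dp-minimal if all its one-variable types have dp-rank at most 1 (algebraic types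
have rank 0). -/
def IsDpMinimal (T : L.Theory) : Prop :=
  TypesDpRankLE.{u, v, w} T 1 1

end

end DpRank

/-! The carrying notion is the rank of a tuple, `TupleRankLE`: among any `1 + k` mutually
indiscernible sequences over any base set, in any elementary extension, one stays indiscernible
after adding the tuple. A bound on the dp-rank of a type over `∅` gives it for every realization,
since a failure over a base involves only finitely many parameters, which can be appended to all
members of all sequences (`tupleRankLE_of_empty`).

Subadditivity rests on `MutuallyIndiscernible.exists_on`: if `a` has rank at most `k`, deleting at
most `k` sequences leaves a family that is mutually indiscernible over `a`, not merely one
indiscernible sequence. Call a subfamily good if it is mutually indiscernible over `C ∪ a`, and take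
a maximal good `E`. If no sequence outside `E` is indiscernible over `C`, `a` and the sequences in
`E`, then the rank bound leaves at most `k` sequences outside `E`. Otherwise some `I s` is. Its
limit tuples are then added to `C` (`MutuallyIndiscernible.exists_limit_params`). The whole family
remains mutually indiscernible over the new base, but `E` is no longer good, because the limits have
over `a` and `E` the same type as members of `I s`. Subfamilies good over the larger base were good
before, so the finite number of good subfamilies drops and the process ends. Adding the coordinates
of a tuple one by one then gives the sum of their ranks (`TupleRankLE.of_coordinates`).

For alternation, `2k + 1` changes of truth value would give `k + 1` disjoint intervals of one
indiscernible sequence, with a change between the endpoints of each. Stretched to be infinite, they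
are mutually indiscernible, so one is indiscernible over `c`: a contradiction. This yields the bound
`2k`, slightly better than required. -/

namespace DpRank

/-! ### Equality of types for tuples of arbitrary length -/

section SameType

variable {L : FirstOrder.Language.{u, v}} {N : Type w} [L.Structure N]

/-- The tuples `x` and `y`, indexed by an arbitrary type, have the same type over `C`. -/
def SameType (L : FirstOrder.Language.{u, v}) {N : Type w} [L.Structure N] (C : Set N)
    {X : Type*} (x y : X → N) : Prop :=
  ∀ φ : L.Formula (C ⊕ X), φ.Realize (Sum.elim (fun c : C => (c : N)) x) ↔
    φ.Realize (Sum.elim (fun c : C => (c : N)) y)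

theorem SameType.refl (C : Set N) {X : Type*} (x : X → N) : SameType L C x x := fun _ => Iff.rfl

theorem SameType.trans {C : Set N} {X : Type*} {x y z : X → N} (h : SameType L C x y)
    (h' : SameType L C y z) : SameType L C x z := fun φ => (h φ).trans (h' φ)

/-- A tuple all of whose coordinates are constants or coordinates of another tuple inherits
equality of types from that tuple. -/
theorem SameType.transfer {C D : Set N} {X Y : Type*} {x x' : X → N} {y y' : Y → N}
    (h : SameType L C x x') (hD : D ⊆ C)
    (hy : ∀ q, (y q ∈ C ∧ y' q = y q) ∨ ∃ p, y q = x p ∧ y' q = x' p) : SameType L D y y' := by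
  classical
  have : ∀ q, ∃ t : C ⊕ X, y q = Sum.elim (fun c : C => (c : N)) x t ∧
      y' q = Sum.elim (fun c : C => (c : N)) x' t := by
    intro q
    rcases hy q with ⟨h1, h2⟩ | ⟨p, h1, h2⟩
    · exact ⟨.inl ⟨y q, h1⟩, rfl, h2⟩
    · exact ⟨.inr p, h1, h2⟩
  choose t ht ht' using this
  intro φ
  have := h (φ.relabel (Sum.elim (fun d => Sum.inl (Set.inclusion hD d)) t))
  rw [FirstOrder.Language.Formula.realize_relabel,
    FirstOrder.Language.Formula.realize_relabel] at this
  convert! this using 2 <;> · funext q; cases q <;> simp [ht, ht']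

theorem SameType.mono {C D : Set N} {X : Type*} {x x' : X → N}
    (h : SameType L C x x') (hD : D ⊆ C) : SameType L D x x' :=
  h.transfer hD fun q => .inr ⟨q, rfl, rfl⟩

/-- Variables with equal values can be turned into parameters. -/
theorem SameType.of_params {C D : Set N} {W X : Type*} {z : W → N} {x x' : X → N}
    (h : SameType L C (Sum.elim z x) (Sum.elim z x')) (hD : D ⊆ C ∪ range z) :
    SameType L D x x' := by
  classical
  have : ∀ d : D, ∃ t : C ⊕ W, (d : N) = Sum.elim (fun c : C => (c : N)) z t := by
    intro d
    rcases hD d.2 with h1 | ⟨w, h1⟩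
    · exact ⟨.inl ⟨d, h1⟩, rfl⟩
    · exact ⟨.inr w, h1.symm⟩
  choose t ht using this
  intro φ
  have := h (φ.relabel (Sum.elim (fun d => Sum.elim Sum.inl (Sum.inr ∘ Sum.inl) (t d))
    (Sum.inr ∘ Sum.inr)))
  rw [FirstOrder.Language.Formula.realize_relabel,
    FirstOrder.Language.Formula.realize_relabel] at this
  convert! this using 2
  all_goals
    funext q
    rcases q with d | q
    · simp only [Sum.elim_inl, Function.comp, ht d]
      cases t d <;> rfl
    · rfl

/-- Parameters can be turned into variables. -/
theorem SameType.to_params {C D : Set N} {W X : Type*} {z : W → N} {x x' : X → N}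
    (h : SameType L D x x') (hC : C ⊆ D) (hz : range z ⊆ D) :
    SameType L C (Sum.elim z x) (Sum.elim z x') :=
  h.transfer hC fun q => by
    rcases q with q | q
    · exact .inl ⟨hz ⟨q, rfl⟩, rfl⟩
    · exact .inr ⟨q, rfl, rfl⟩

/-- A formula depends only on finitely many of its variables. -/
theorem exists_finite_support {α : Type*} {X : Type*} (φ : L.Formula (α ⊕ X)) :
    ∃ (F : Finset X) (ψ : L.Formula (α ⊕ F)), ∀ (M : Type w) [L.Structure M] (a : α → M) (x : X → M),
      φ.Realize (Sum.elim a x) ↔ ψ.Realize (Sum.elim a (fun q : F => x q)) := by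
  classical
  let F : Finset X := φ.freeVarFinset.toRight
  refine ⟨F, φ.restrictFreeVar fun q => match q with
    | ⟨.inl c, _⟩ => .inl c
    | ⟨.inr q, h⟩ => .inr ⟨q, by simpa [F] using h⟩, fun M _ a x => ?_⟩
  refine (FirstOrder.Language.BoundedFormula.realize_restrictFreeVar _ ?_).symm
  rintro ⟨q | q, h⟩ <;> rfl

theorem SameType.of_finite {C : Set N} {X : Type*} {x y : X → N}
    (h : ∀ F : Finset X, SameType L C (fun q : F => x q) (fun q : F => y q)) :
    SameType L C x y := by
  intro φ
  obtain ⟨F, ψ, hψ⟩ := exists_finite_support φ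
  rw [hψ, hψ]
  exact h F ψ

/-- A formula mentions finitely many parameters; the proof swaps the roles of parameters and
variables to reuse `exists_finite_support`. -/
theorem SameType.of_finite_params {C : Set N} {X : Type*} {x y : X → N}
    (h : ∀ B : Finset N, (B : Set N) ⊆ C → SameType L (B : Set N) x y) : SameType L C x y := by
  classical
  intro φ
  obtain ⟨F, ψ, hψ⟩ := exists_finite_support
    (φ.relabel (Sum.swap : C ⊕ X → X ⊕ C))
  have key : ∀ z : X → N, φ.Realize (Sum.elim (fun c : C => (c : N)) z) ↔
      ψ.Realize (Sum.elim z (fun q : F => ((q : C) : N))) := by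
    intro z
    rw [← hψ N z (fun c : C => (c : N)), FirstOrder.Language.Formula.realize_relabel]
    convert! Iff.rfl using 2
    funext q; cases q <;> rfl
  rw [key, key]
  have := h (F.image Subtype.val) (by intro c; simp; tauto)
    (ψ.relabel (Sum.elim Sum.inr fun q : F => Sum.inl ⟨((q : C) : N), by
      exact_mod_cast Finset.mem_image_of_mem _ q.2⟩))
  rw [FirstOrder.Language.Formula.realize_relabel,
    FirstOrder.Language.Formula.realize_relabel] at this
  convert! this using 2 <;> · funext q; cases q <;> rfl

/-- Elementary embeddings preserve and reflect equality of types. -/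
theorem sameType_map_iff {N' : Type w} [L.Structure N'] (f : N ↪ₑ[L] N') {C : Set N} {X : Type*}
    {x y : X → N} : SameType L (f '' C) (f ∘ x) (f ∘ y) ↔ SameType L C x y := by
  have hf : ∀ c : C, f c ∈ f '' C := fun c => ⟨c, c.2, rfl⟩
  constructor
  · intro h φ
    have := h (φ.relabel (Sum.map (fun c : C => ⟨f c, hf c⟩) id))
    rw [FirstOrder.Language.Formula.realize_relabel,
      FirstOrder.Language.Formula.realize_relabel] at this
    rw [← f.map_formula, ← f.map_formula φ]
    convert! this using 2 <;> · funext q; cases q <;> rfl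
  · intro h φ
    have hg : ∀ d : f '' C, ∃ c : C, f c = d := fun ⟨d, c, hc, h⟩ => ⟨⟨c, hc⟩, h⟩
    choose g hg using hg
    have := h (φ.relabel (Sum.map g id))
    rw [← f.map_formula, ← f.map_formula (φ.relabel _),
      FirstOrder.Language.Formula.realize_relabel,
      FirstOrder.Language.Formula.realize_relabel] at this
    convert! this using 2 <;> · funext q; cases q <;> simp [hg]

end SameType

/-! ### Compactness via ultrapowers -/

section Extensions

open Filter FirstOrder.Language

/-- Limits of tuples along a filter exist in an elementary extension (an ultrapower): every formula
that holds eventually holds for the limit. -/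
theorem exists_limit {L : FirstOrder.Language.{u, v}} {N : Type w} [L.Structure N] [Nonempty N]
    {ι : Type w} (l : Filter ι) [l.NeBot] {X : Type*} (x : ι → X → N) :
    ∃ (N' : Type w) (_ : L.Structure N') (f : N ↪ₑ[L] N') (x' : X → N'),
      ∀ φ : L.Formula (N ⊕ X), (∀ᶠ i in l, φ.Realize (Sum.elim id (x i))) →
        φ.Realize (Sum.elim f x') := by
  let U : Ultrafilter ι := Ultrafilter.of l
  let c : (ι → N) → (U : Filter ι).Product (fun _ => N) := fun g => (g : _)
  refine ⟨(U : Filter ι).Product (fun _ => N), inferInstance,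
    ⟨fun b => c fun _ => b, fun n φ y => ?_⟩, fun q => c fun i => x i q, fun φ hφ => ?_⟩
  · exact (Ultraproduct.realize_formula_cast φ fun b _ => y b).trans Filter.eventually_const
  · have h2 := (Ultraproduct.realize_formula_cast (u := U) (M := fun _ => N) φ
      (Sum.elim (fun b _ => b) fun q i => x i q)).2 ?_
    · refine (iff_of_eq (congrArg φ.Realize (funext fun q => ?_))).2 h2
      cases q <;> rfl
    · have h3 : ∀ᶠ i in (U : Filter ι), φ.Realize (Sum.elim id (x i)) := Ultrafilter.of_le l hφ
      refine h3.mono fun i hi => ?_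
      convert! hi using 2
      rename_i q
      cases q <;> rfl

/-- Existential quantification over arbitrarily many variables. -/
theorem exists_exs {L : FirstOrder.Language.{u, v}} {α X : Type*} (φ : L.Formula (α ⊕ X)) :
    ∃ ψ : L.Formula α, ∀ (M : Type w) [L.Structure M] [Nonempty M] (a : α → M),
      ψ.Realize a ↔ ∃ x : X → M, φ.Realize (Sum.elim a x) := by
  classical
  obtain ⟨F, ψ, hψ⟩ := exists_finite_support.{u, v, w} φ
  refine ⟨ψ.iExs F, fun M _ _ a => ?_⟩
  rw [Formula.realize_iExs]
  constructor
  · rintro ⟨y, hy⟩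
    refine ⟨fun q => if h : q ∈ F then y ⟨q, h⟩ else Classical.arbitrary M, (hψ M _ _).2 ?_⟩
    simpa using hy
  · rintro ⟨x, hx⟩
    exact ⟨_, (hψ M _ _).1 hx⟩

/-- A set of formulas is realized in an elementary extension by a tuple some of whose coordinates
are prescribed elements `z`, provided that it is approximately realized by tuples for which these
coordinates approximate the type of `z`. -/
theorem exists_extension {L : FirstOrder.Language.{u, v}} {N : Type (max u v w)} [L.Structure N]
    [Nonempty N] {C : Set N} {W X : Type (max u v w)} (z : W → N) (e : W → X)
    (Γ : Set (L.Formula (C ⊕ X))) {ι : Type*} (l : Filter ι) [l.NeBot] (x : ι → X → N)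
    (hΓ : ∀ φ ∈ Γ, ∀ᶠ i in l, φ.Realize (Sum.elim (fun c : C => (c : N)) (x i)))
    (hz : ∀ φ : L.Formula (C ⊕ W), φ.Realize (Sum.elim (fun c : C => (c : N)) z) →
      ∀ᶠ i in l, φ.Realize (Sum.elim (fun c : C => (c : N)) (x i ∘ e))) :
    ∃ (N' : Type (max u v w)) (_ : L.Structure N') (f : N ↪ₑ[L] N') (x' : X → N'),
      (∀ w, x' (e w) = f (z w)) ∧
        ∀ φ ∈ Γ, φ.Realize (Sum.elim (fun c : C => f c) x') := by
  classical
  have approx : ∀ (p : Finset Γ × Finset W), ∃ y : X → N, (∀ w ∈ p.2, y (e w) = z w) ∧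
      ∀ φ ∈ p.1, (φ : L.Formula (C ⊕ X)).Realize (Sum.elim (fun c : C => (c : N)) y) := by
    rintro ⟨q, G⟩
    let θ : L.Formula ((C ⊕ W) ⊕ X) :=
      (Formula.iInf fun w : G => Term.equal (Term.var (.inr (e w))) (Term.var (.inl (.inr w.1)))) ⊓
      (Formula.iInf fun φ : q => φ.1.1.relabel (Sum.map Sum.inl id))
    have hθ : ∀ (z : W → N) (y : X → N),
        θ.Realize (Sum.elim (Sum.elim (fun c : C => (c : N)) z) y) ↔
        (∀ w ∈ G, y (e w) = z w) ∧
      ∀ φ ∈ q, (φ : L.Formula (C ⊕ X)).Realize (Sum.elim (fun c : C => (c : N)) y) := by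
      intro z y
      simp only [θ, Formula.realize_inf, Formula.realize_iInf, Formula.realize_equal,
        Term.realize_var, Formula.realize_relabel, Subtype.forall, Sum.elim_comp_map,
        Sum.elim_inr, Sum.elim_inl, Function.comp_id, Sum.elim_comp_inl]
    obtain ⟨ψ, hψ⟩ := exists_exs.{u, v, max u v w} θ
    -- Approximability is an existential property `ψ` of finitely many coordinates of `z`. If it
    -- failed, its negation would eventually hold of `x i ∘ e`, yet `x i` itself is eventually a
    -- witness for `ψ`.
    by_contra hcon
    have h1 : ¬ ψ.Realize (Sum.elim (fun c : C => (c : N)) z) := by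
      rw [hψ]
      rintro ⟨y, hy⟩
      exact hcon ⟨y, (hθ z y).1 hy⟩
    have h2 := hz ψ.not (Formula.realize_not.2 h1)
    have h3 : ∀ᶠ i in l, ∀ φ ∈ q,
        (φ : L.Formula (C ⊕ X)).Realize (Sum.elim (fun c : C => (c : N)) (x i)) :=
      (Filter.eventually_all_finset q).2 fun φ _ => hΓ φ φ.2
    obtain ⟨i, h4, h5⟩ := (h2.and h3).exists
    rw [Formula.realize_not, hψ] at h4
    exact h4 ⟨x i, (hθ _ _).2 ⟨fun _ _ => rfl, h5⟩⟩
  choose y hy hy' using approx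
  obtain ⟨N', _, f, x', h⟩ := exists_limit (L := L) (Filter.atTop : Filter (Finset Γ × Finset W)) y
  refine ⟨N', _, f, x', fun w => ?_, fun φ hφ => ?_⟩
  · have := h (Term.equal (Term.var (.inr (e w))) (Term.var (.inl (z w)))) ?_
    · simpa [Formula.realize_equal] using this
    · filter_upwards [Filter.eventually_ge_atTop ((∅, {w}) : Finset Γ × Finset W)] with p hp
      simpa [Formula.realize_equal] using hy p w (hp.2 (by simp))
  · have := h (φ.relabel (Sum.map Subtype.val id)) ?_
    · rw [Formula.realize_relabel, Sum.elim_comp_map] at this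
      exact this
    · filter_upwards [Filter.eventually_ge_atTop (({⟨φ, hφ⟩}, ∅) : Finset Γ × Finset W)] with p hp
      have := hy' p ⟨φ, hφ⟩ (hp.1 (by simp))
      rw [Formula.realize_relabel, Sum.elim_comp_map]
      exact this

end Extensions

/-! ### Indiscernible and mutually indiscernible families -/

section Indiscernible

variable {L : FirstOrder.Language.{u, v}} {N : Type w} [L.Structure N]

theorem Indiscernible.mono {C D : Set N} {J : Type w} [LinearOrder J] {m : ℕ} {I : J → Fin m → N}
    (h : Indiscernible L C I) (hD : D ⊆ C) : Indiscernible L D I :=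
  fun r φ i i' hi hi' => SameType.mono (L := L)
    (x := fun q : Fin r × Fin m => I (i q.1) q.2) (x' := fun q => I (i' q.1) q.2)
    (fun φ => h r φ i i' hi hi') hD φ

/-- Extends the definition from finite increasing sequences to index sets of any size: only finitely
many indices matter, and these can be listed in increasing order. -/
theorem Indiscernible.sameType {C : Set N} {J : Type w} [LinearOrder J] {m : ℕ}
    {I : J → Fin m → N} (h : Indiscernible L C I) {K : Type*} [LinearOrder K] (P : Set K)
    {i i' : K → J} (hi : StrictMonoOn i P) (hi' : StrictMonoOn i' P) :
    SameType L C (fun q : P × Fin m => I (i q.1) q.2) (fun q => I (i' q.1) q.2) := by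
  classical
  refine SameType.of_finite fun F => ?_
  let G : Finset K := F.image fun q => q.1.1
  have hG : ∀ k ∈ G, k ∈ P := by
    intro k hk
    obtain ⟨q, -, rfl⟩ := Finset.mem_image.1 hk
    exact q.1.2
  let e := G.orderEmbOfFin rfl
  have he : ∀ a, e a ∈ P := fun a => hG _ (G.orderEmbOfFin_mem rfl a)
  have := fun φ => h G.card φ (i ∘ e) (i' ∘ e)
    (fun a b hab => hi (he a) (he b) (e.strictMono hab))
    (fun a b hab => hi' (he a) (he b) (e.strictMono hab))
  refine SameType.transfer (L := L) (x := fun q : Fin G.card × Fin m => I ((i ∘ e) q.1) q.2)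
    (x' := fun q => I ((i' ∘ e) q.1) q.2) this subset_rfl fun q => .inr ?_
  have hq : q.1.1.1 ∈ Set.range e := by
    rw [Finset.range_orderEmbOfFin]
    exact Finset.mem_coe.2 (Finset.mem_image_of_mem _ q.2)
  obtain ⟨a, ha⟩ := hq
  exact ⟨(a, q.1.2), by simp [ha], by simp [ha]⟩

theorem indiscernible_map_iff {N' : Type w} [L.Structure N'] (f : N ↪ₑ[L] N') {C : Set N}
    {J : Type w} [LinearOrder J] {m : ℕ} {I : J → Fin m → N} :
    Indiscernible L (f '' C) (fun j t => f (I j t)) ↔ Indiscernible L C I :=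
  forall_congr' fun r => by
    constructor
    · intro h φ i i' hi hi'
      exact (sameType_map_iff f (x := fun q : Fin r × Fin m => I (i q.1) q.2)
        (y := fun q => I (i' q.1) q.2)).1 (fun φ => h φ i i' hi hi') φ
    · intro h φ i i' hi hi'
      exact (sameType_map_iff f (x := fun q : Fin r × Fin m => I (i q.1) q.2)
        (y := fun q => I (i' q.1) q.2)).2 (fun φ => h φ i i' hi hi') φ

theorem Indiscernible.comp {C : Set N} {J : Type w} [LinearOrder J] {m : ℕ}
    {I : J → Fin m → N} (h : Indiscernible L C I) {K : Type w} [LinearOrder K] {e : K → J}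
    (he : StrictMono e) : Indiscernible L C (I ∘ e) :=
  fun r φ i i' hi hi' => h r φ (e ∘ i) (e ∘ i') (he.comp hi) (he.comp hi')

variable {S : Type} {J : S → Type w} [∀ s, LinearOrder (J s)] {m : S → ℕ}

/-- The subfamily indexed by `E` of a family of sequences is mutually indiscernible. -/
def MutuallyIndiscernibleOn (L : FirstOrder.Language.{u, v}) {N : Type w} [L.Structure N]
    (C : Set N) {S : Type} {J : S → Type w} [∀ s, LinearOrder (J s)] {m : S → ℕ}
    (I : ∀ s, J s → Fin (m s) → N) (E : Set S) : Prop :=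
  ∀ s ∈ E, Indiscernible L (C ∪ {b | ∃ t ∈ E, t ≠ s ∧ b ∈ entries (I t)}) (I s)

theorem mutuallyIndiscernibleOn_univ {C : Set N} {I : ∀ s, J s → Fin (m s) → N} :
    MutuallyIndiscernibleOn L C I univ ↔ MutuallyIndiscernible L C I := by
  have : ∀ s, {b | ∃ t ∈ (univ : Set S), t ≠ s ∧ b ∈ entries (I t)} =
      ⋃ (t) (_ : t ≠ s), entries (I t) := by
    intro s; ext b; simp
  unfold MutuallyIndiscernibleOn MutuallyIndiscernible
  refine forall_congr' fun s => ?_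
  rw [this]
  simp only [mem_univ, true_imp_iff]

theorem MutuallyIndiscernibleOn.mono {C D : Set N} {I : ∀ s, J s → Fin (m s) → N} {E E' : Set S}
    (h : MutuallyIndiscernibleOn L C I E) (hD : D ⊆ C) (hE : E' ⊆ E) :
    MutuallyIndiscernibleOn L D I E' :=
  fun s hs => (h s (hE hs)).mono <| union_subset_union hD
    fun _ ⟨t, ht, hts, hb⟩ => ⟨t, hE ht, hts, hb⟩

theorem entries_map {N' J : Type w} {m : ℕ} (f : N → N') (I : J → Fin m → N) :
    entries (fun j t => f (I j t)) = f '' entries I := by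
  ext b
  constructor
  · rintro ⟨j, t, rfl⟩
    exact ⟨_, ⟨j, t, rfl⟩, rfl⟩
  · rintro ⟨_, ⟨j, t, rfl⟩, rfl⟩
    exact ⟨j, t, rfl⟩

theorem mutuallyIndiscernibleOn_map_iff {N' : Type w} [L.Structure N'] (f : N ↪ₑ[L] N')
    {C : Set N} {I : ∀ s, J s → Fin (m s) → N} {E : Set S} :
    MutuallyIndiscernibleOn L (f '' C) (fun s j t => f (I s j t)) E ↔
      MutuallyIndiscernibleOn L C I E := by
  refine forall₂_congr fun s _ => ?_
  rw [← indiscernible_map_iff f, image_union]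
  have : {b | ∃ t ∈ E, t ≠ s ∧ b ∈ entries fun j τ => f (I t j τ)} =
      f '' {b | ∃ t ∈ E, t ≠ s ∧ b ∈ entries (I t)} := by
    ext b
    constructor
    · rintro ⟨t, ht, hts, hb⟩
      rw [entries_map] at hb
      obtain ⟨c, hc, rfl⟩ := hb
      exact ⟨c, ⟨t, ht, hts, hc⟩, rfl⟩
    · rintro ⟨c, ⟨t, ht, hts, hc⟩, rfl⟩
      exact ⟨t, ht, hts, entries_map f (I t) ▸ mem_image_of_mem f hc⟩
  rw [this]

theorem mutuallyIndiscernibleOn_reindex {S' : Type} {e : S' → S} (he : Function.Injective e)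
    {C : Set N} {I : ∀ s, J s → Fin (m s) → N} {E : Set S'} :
    MutuallyIndiscernibleOn L C (fun s => I (e s)) E ↔ MutuallyIndiscernibleOn L C I (e '' E) := by
  have : ∀ s, {b | ∃ t ∈ e '' E, t ≠ e s ∧ b ∈ entries (I t)} =
      {b | ∃ t ∈ E, t ≠ s ∧ b ∈ entries (I (e t))} := by
    intro s; ext b; simp [he.eq_iff]
  simp only [MutuallyIndiscernibleOn, forall_mem_image, this]

/-- Members of mutually indiscernible sequences can be moved simultaneously, in an order preserving
way, without changing their joint type. -/
theorem MutuallyIndiscernible.sameType [Finite S] {C : Set N} {I : ∀ s, J s → Fin (m s) → N}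
    (h : MutuallyIndiscernible L C I) {K : S → Type*} [∀ s, LinearOrder (K s)]
    (P : ∀ s, Set (K s)) {i i' : ∀ s, K s → J s} (hi : ∀ s, StrictMonoOn (i s) (P s))
    (hi' : ∀ s, StrictMonoOn (i' s) (P s)) :
    SameType L C (fun q : Σ s, P s × Fin (m s) => I q.1 (i q.1 q.2.1) q.2.2)
      (fun q => I q.1 (i' q.1 q.2.1) q.2.2) := by
  classical
  cases nonempty_fintype S
  -- The sequences are moved one at a time; while `I s` moves, all the others serve as parameters.
  have key : ∀ T : Finset S, SameType L C
      (fun q : Σ s, P s × Fin (m s) => I q.1 (i q.1 q.2.1) q.2.2)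
      (fun q => I q.1 ((if q.1 ∈ T then i' q.1 else i q.1) q.2.1) q.2.2) := by
    intro T
    induction T using Finset.induction_on with
    | empty => simpa using SameType.refl C _
    | insert s T hs ih =>
      refine ih.trans (((h s).sameType (P s) (hi s) (hi' s)).transfer subset_union_left ?_)
      rintro ⟨t, k, τ⟩
      by_cases hts : t = s
      · subst hts
        exact .inr ⟨(k, τ), by simp [hs], by simp⟩
      · refine .inl ⟨.inr (mem_iUnion₂.2 ⟨t, hts, _, _, rfl⟩), by simp [hts]⟩
  simpa using key Finset.univ

/-- Converse of `MutuallyIndiscernible.sameType`, in a form whose hypothesis is a set of formulas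
about finitely many members, hence suited to compactness. -/
theorem MutuallyIndiscernible.of_sameType {C : Set N} {I : ∀ s, J s → Fin (m s) → N}
    (h : ∀ (P : ∀ s, Finset (J s)) (g : ∀ s, J s → J s),
      (∀ s, StrictMonoOn (g s) (P s : Set (J s))) →
      SameType L C (fun q : Σ s, P s × Fin (m s) => I q.1 q.2.1 q.2.2)
        (fun q => I q.1 (g q.1 q.2.1) q.2.2)) :
    MutuallyIndiscernible L C I := by
  classical
  intro s r φ i i' hi hi'
  let W := Σ t : {t // t ≠ s}, J t × Fin (m t)
  let z : W → N := fun q => I q.1 q.2.1 q.2.2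
  refine SameType.of_params (L := L) (C := C) (z := z)
    (x := fun q : Fin r × Fin (m s) => I s (i q.1) q.2) (x' := fun q => I s (i' q.1) q.2) ?_ ?_ φ
  · refine SameType.of_finite fun F => ?_
    let idx : W ⊕ (Fin r × Fin (m s)) → Σ t, J t :=
      Sum.elim (fun q => ⟨q.1, q.2.1⟩) fun q => ⟨s, i q.1⟩
    let P : ∀ t, Finset (J t) := fun t =>
      (F.image idx).preimage (Sigma.mk t) sigma_mk_injective.injOn
    have hP : ∀ q ∈ F, (idx q).2 ∈ P (idx q).1 := fun q hq => by
      simp only [P, Finset.mem_preimage]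
      exact Finset.mem_image_of_mem idx hq
    -- Only the sequence `s` moves, from `i` to `i'`; the members of the others, standing for
    -- parameters, are fixed.
    let g : ∀ t, J t → J t := Function.update (fun t => id) s (Function.extend i i' id)
    have hgs : ∀ a, g s (i a) = i' a := fun a => by simp [g, hi.injective.extend_apply]
    have hgt : ∀ t, t ≠ s → g t = id := fun t ht => by simp [g, ht]
    have hg : ∀ t, StrictMonoOn (g t) (P t : Set (J t)) := by
      intro t
      by_cases ht : t = s
      · subst ht
        have : ∀ j ∈ P t, ∃ a, i a = j := by
          intro j hj
          simp only [P, Finset.mem_preimage, Finset.mem_image] at hj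
          obtain ⟨q, -, hq⟩ := hj
          rcases q with q | q
          · exact absurd (congrArg Sigma.fst hq) q.1.2
          · exact ⟨q.1, eq_of_heq (Sigma.mk.inj hq).2⟩
        intro j hj j' hj' hjj'
        obtain ⟨a, rfl⟩ := this j hj
        obtain ⟨a', rfl⟩ := this j' hj'
        rw [hgs, hgs]
        exact hi' (hi.lt_iff_lt.1 hjj')
      · rw [hgt t ht]
        exact strictMono_id.strictMonoOn _
    refine (h P g hg).transfer subset_rfl ?_
    rintro ⟨q, hq⟩
    right
    have h1 := hP q hq
    rcases q with q | q
    · exact ⟨⟨q.1, ⟨q.2.1, h1⟩, q.2.2⟩, rfl, by simp [hgt _ q.1.2, z]⟩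
    · exact ⟨⟨s, ⟨i q.1, h1⟩, q.2⟩, rfl, by simp [hgs]⟩
  · refine union_subset_union_right _ fun b hb => ?_
    obtain ⟨t, ht, j, τ, rfl⟩ := mem_iUnion₂.1 hb
    exact ⟨⟨⟨t, ht⟩, j, τ⟩, rfl⟩

theorem exists_strictMonoOn {K J : Type*} [LinearOrder K] [LinearOrder J] [Infinite J]
    (P : Finset K) : ∃ e : K → J, StrictMonoOn e (P : Set K) := by
  classical
  obtain ⟨Q, hQ⟩ := Infinite.exists_subset_card_eq J P.card
  obtain ⟨j⟩ : Nonempty J := inferInstance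
  let e := Q.orderEmbOfFin hQ
  let o := P.orderIsoOfFin rfl
  refine ⟨fun k => if h : k ∈ P then e (o.symm ⟨k, h⟩) else j, fun a ha b hb hab => ?_⟩
  have ha' : a ∈ P := ha
  have hb' : b ∈ P := hb
  simp only [ha', hb', dif_pos]
  exact e.strictMono (o.symm.strictMono hab)

end Indiscernible

/-! ### Stretching mutually indiscernible sequences -/

section Stretch

open FirstOrder.Language

/-- Mutually indiscernible sequences can be extended to any larger index orders, in an elementary
extension. -/
theorem MutuallyIndiscernible.exists_stretch {L : FirstOrder.Language.{u, v}}
    {N : Type (max u v w)} [L.Structure N] [Nonempty N] {S : Type} [Finite S]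
    {J J' : S → Type (max u v w)} [∀ s, LinearOrder (J s)] [∀ s, LinearOrder (J' s)]
    [∀ s, Infinite (J s)] (emb : ∀ s, J s ↪o J' s) {m : S → ℕ} {I : ∀ s, J s → Fin (m s) → N}
    {C : Set N} (h : MutuallyIndiscernible L C I) :
    ∃ (N' : Type (max u v w)) (_ : L.Structure N') (f : N ↪ₑ[L] N')
      (I' : ∀ s, J' s → Fin (m s) → N'), MutuallyIndiscernible L (f '' C) I' ∧
        ∀ s j t, I' s (emb s j) t = f (I s j t) := by
  classical
  cases nonempty_fintype S
  let X := Σ s, J' s × Fin (m s)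
  let W := Σ s, J s × Fin (m s)
  -- `Γ` expresses mutual indiscernibility of the stretched family. It is approximated by `x G`,
  -- which pulls the finitely many new indices in `G` back to old ones by order preserving maps `ρ
  -- G`.
  let Γ : Set (L.Formula (C ⊕ X)) := {ψ | ∃ (P : ∀ s, Finset (J' s)) (g : ∀ s, J' s → J' s)
    (φ : L.Formula (C ⊕ Σ s, P s × Fin (m s))), (∀ s, StrictMonoOn (g s) (P s : Set (J' s))) ∧
    ψ = (φ.relabel (Sum.map id fun q => (⟨q.1, q.2.1, q.2.2⟩ : X))).iff
      (φ.relabel (Sum.map id fun q => (⟨q.1, g q.1 q.2.1, q.2.2⟩ : X)))}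
  have hρ : ∀ (G : Finset (Σ s, J' s)) (s : S), ∃ ρ : J' s → J s,
      StrictMonoOn ρ {k | (⟨s, k⟩ : Σ s, J' s) ∈ G} := by
    intro G s
    obtain ⟨ρ, hρ⟩ := exists_strictMonoOn (J := J s)
      (G.preimage (Sigma.mk s) sigma_mk_injective.injOn)
    exact ⟨ρ, hρ.mono fun k hk => by simpa using hk⟩
  choose ρ hρ using hρ
  let x : Finset (Σ s, J' s) → X → N := fun G q => I q.1 (ρ G q.1 q.2.1) q.2.2
  have hΓ : ∀ φ ∈ Γ, ∀ᶠ G in Filter.atTop,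
      φ.Realize (Sum.elim (fun c : C => (c : N)) (x G)) := by
    rintro _ ⟨P, g, φ, hg, rfl⟩
    let G₀ : Finset (Σ s, J' s) := Finset.univ.sigma P ∪ Finset.univ.sigma fun s => (P s).image (g s)
    filter_upwards [Filter.eventually_ge_atTop G₀] with G hG
    simp only [Formula.realize_iff, Formula.realize_relabel, Sum.elim_comp_map, Function.comp_id]
    refine h.sameType (fun s => (P s : Set (J' s))) (i := ρ G) (i' := fun s => ρ G s ∘ g s)
      (fun s => (hρ G s).mono fun k hk => hG ?_) (fun s => ?_) φ
    · have hk' : k ∈ P s := hk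
      simp [G₀, hk']
    · refine (hρ G s).comp (hg s) fun k hk => hG ?_
      have hk' : k ∈ P s := hk
      simp only [G₀, Finset.mem_union, Finset.mem_sigma, Finset.mem_univ, true_and]
      exact .inr (Finset.mem_image_of_mem _ hk')
  have hz : ∀ φ : L.Formula (C ⊕ W),
      φ.Realize (Sum.elim (fun c : C => (c : N)) fun q : W => I q.1 q.2.1 q.2.2) →
      ∀ᶠ G in Filter.atTop, φ.Realize (Sum.elim (fun c : C => (c : N))
        (x G ∘ fun q : W => (⟨q.1, emb q.1 q.2.1, q.2.2⟩ : X))) := by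
    intro φ hφ
    obtain ⟨F, ψ, hψ⟩ := exists_finite_support.{u, v, max u v w} φ
    let G₀ : Finset (Σ s, J' s) := F.image fun q => ⟨q.1, emb q.1 q.2.1⟩
    filter_upwards [Filter.eventually_ge_atTop G₀] with G hG
    rw [hψ] at hφ ⊢
    let P : ∀ s, Set (J s) := fun s => {j | (⟨s, emb s j⟩ : Σ s, J' s) ∈ G}
    have hP : ∀ q : F, q.1.2.1 ∈ P q.1.1 := fun q => hG (Finset.mem_image_of_mem _ q.2)
    refine ((h.sameType P (i := fun s => id) (i' := fun s => ρ G s ∘ emb s)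
      (fun s => strictMono_id.strictMonoOn _) (fun s => ?_)).transfer subset_rfl
        (fun q => .inr ⟨⟨q.1.1, ⟨q.1.2.1, hP q⟩, q.1.2.2⟩, rfl, rfl⟩) ψ).1 hφ
    exact (hρ G s).comp ((emb s).strictMono.strictMonoOn _) fun k hk => hk
  obtain ⟨N', _, f, x', hx, hx'⟩ := exists_extension (L := L) (C := C)
    (z := fun q : W => I q.1 q.2.1 q.2.2)
    (e := fun q : W => (⟨q.1, emb q.1 q.2.1, q.2.2⟩ : X)) Γ
    Filter.atTop x hΓ hz
  refine ⟨N', _, f, fun s k t => x' ⟨s, k, t⟩, ?_, fun s j t => hx ⟨s, j, t⟩⟩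
  refine MutuallyIndiscernible.of_sameType fun P g hg φ => ?_
  have hc : ∀ d : f '' C, ∃ c : C, f c = d := fun ⟨d, c, hc, h⟩ => ⟨⟨c, hc⟩, h⟩
  choose c hc using hc
  have := hx' _ ⟨P, g, φ.relabel (Sum.map c id), hg, rfl⟩
  simp only [Formula.realize_iff, Formula.realize_relabel] at this
  convert! this using 2
  all_goals
    funext q
    rcases q with d | q
    · simp [hc]
    · rfl

end Stretch

/-! ### Adding limits of a sequence to the base -/

section Limit

open FirstOrder.Language

/-- Limits of tuples along a filter, in terms of equality of types. -/
theorem exists_limit_sameType {L : FirstOrder.Language.{u, v}} {N : Type w} [L.Structure N]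
    [Nonempty N] {ι : Type w} (l : Filter ι) [l.NeBot] {X : Type} (x : ι → X → N) :
    ∃ (N' : Type w) (_ : L.Structure N') (f : N ↪ₑ[L] N') (x' : X → N'),
      ∀ (O : Set N) {Y : Type} (y y' : Y → N),
        ((∀ᶠ j in l, SameType L O (Sum.elim (x j) y) (Sum.elim (x j) y')) →
          SameType L (f '' O) (Sum.elim x' (f ∘ y)) (Sum.elim x' (f ∘ y'))) ∧
        ∀ φ : L.Formula (O ⊕ (X ⊕ Y)),
          (∀ᶠ j in l, ¬ (φ.Realize (Sum.elim (fun c : O => (c : N)) (Sum.elim (x j) y)) ↔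
            φ.Realize (Sum.elim (fun c : O => (c : N)) (Sum.elim (x j) y')))) →
          ¬ SameType L (f '' O) (Sum.elim x' (f ∘ y)) (Sum.elim x' (f ∘ y')) := by
  obtain ⟨N', _, f, x', H⟩ := exists_limit (L := L) l x
  refine ⟨N', _, f, x', fun O Y y y' => ?_⟩
  let ρ : (Y → N) → O ⊕ (X ⊕ Y) → N ⊕ X := fun y =>
    Sum.elim (fun c => .inl c) (Sum.elim .inr fun q => .inl (y q))
  have hρ : ∀ (φ : L.Formula (O ⊕ (X ⊕ Y))) y j, (φ.relabel (ρ y)).Realize (Sum.elim id (x j)) ↔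
      φ.Realize (Sum.elim (fun c : O => (c : N)) (Sum.elim (x j) y)) := by
    intro φ y j
    rw [Formula.realize_relabel]
    refine iff_of_eq (congrArg φ.Realize (funext fun q => ?_))
    rcases q with q | q | q <;> rfl
  have hρ' : ∀ (φ : L.Formula (O ⊕ (X ⊕ Y))) y, (φ.relabel (ρ y)).Realize (Sum.elim f x') ↔
      φ.Realize (Sum.elim (fun c : O => f c) (Sum.elim x' (f ∘ y))) := by
    intro φ y
    rw [Formula.realize_relabel]
    refine iff_of_eq (congrArg φ.Realize (funext fun q => ?_))
    rcases q with q | q | q <;> rfl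
  constructor
  · intro h φ
    have hc : ∀ d : f '' O, ∃ c : O, f c = d := fun ⟨d, c, hc, h⟩ => ⟨⟨c, hc⟩, h⟩
    choose c hc using hc
    let ψ : L.Formula (O ⊕ (X ⊕ Y)) := φ.relabel (Sum.map c id)
    have := H ((ψ.relabel (ρ y)).iff (ψ.relabel (ρ y'))) (h.mono fun j hj => by
      rw [Formula.realize_iff, hρ, hρ]
      exact hj ψ)
    rw [Formula.realize_iff, hρ', hρ', Formula.realize_relabel, Formula.realize_relabel,
      Sum.elim_comp_map, Sum.elim_comp_map] at this
    simpa only [Function.comp_def, hc, id] using this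
  · intro φ h hs
    have := H ((φ.relabel (ρ y)).iff (φ.relabel (ρ y'))).not (h.mono fun j hj => by
      rwa [Formula.realize_not, Formula.realize_iff, hρ, hρ])
    rw [Formula.realize_not, Formula.realize_iff, hρ', hρ'] at this
    refine this ?_
    have := hs (φ.relabel (Sum.map (fun c : O => ⟨f c, c, c.2, rfl⟩) id))
    rwa [Formula.realize_relabel, Formula.realize_relabel, Sum.elim_comp_map,
      Sum.elim_comp_map] at this

variable {L : FirstOrder.Language.{u, v}} {N : Type w} [L.Structure N] [Nonempty N]
  {S : Type} {J : S → Type w} [∀ s, LinearOrder (J s)] [∀ s, NoMaxOrder (J s)]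
  [∀ s, Nonempty (J s)] {m : S → ℕ}

/-- Suppose that the sequences indexed by `insert s R` are not mutually indiscernible over `D`, but
that the sequence `I s` is indiscernible over `D` and the sequences indexed by `R`. Then one
can add parameters to `C`, namely limits of tuples in `I s`, in such a way that the whole family
remains mutually indiscernible over `C`, while the sequences indexed by `R` are not mutually
indiscernible over `D` and the new parameters. -/
theorem MutuallyIndiscernible.exists_limit_params {C D : Set N} {I : ∀ s, J s → Fin (m s) → N}
    (hI : MutuallyIndiscernible L C I) {s : S} {R : Set S}
    (hs : Indiscernible L (D ∪ {b | ∃ t ∈ R, b ∈ entries (I t)}) (I s))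
    (hR : ¬ MutuallyIndiscernibleOn L D I (insert s R)) :
    ∃ (N' : Type w) (_ : L.Structure N') (f : N ↪ₑ[L] N') (C' : Set N'), f '' C ⊆ C' ∧
      MutuallyIndiscernible L C' (fun s j t => f (I s j t)) ∧
      ¬ MutuallyIndiscernibleOn L (C' ∪ f '' D) (fun s j t => f (I s j t)) R := by
  classical
  -- Each `x j` is an increasing `ω`-sequence of members of `I s` beyond `j`; its limit as `j` grows
  -- supplies the new parameters.
  have : ∀ j : J s, ∃ h : ℕ → J s, StrictMono h ∧ ∀ p, j < h p := by
    intro j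
    obtain ⟨h, hh, h0⟩ := Nat.exists_strictMono' j
    exact ⟨fun p => h (p + 1), fun a b hab => hh (by omega), fun p => h0 ▸ hh (Nat.succ_pos p)⟩
  choose h hh hj using this
  let x : J s → ℕ × Fin (m s) → N := fun j p => I s (h j p.1) p.2
  obtain ⟨N', _, f, x', H⟩ := exists_limit_sameType (L := L) (Filter.atTop : Filter (J s)) x
  refine ⟨N', _, f, f '' C ∪ range x', subset_union_left, ?_, fun hgood => hR ?_⟩
  · intro t r φ i i' hi hi'
    let O : Set N := C ∪ ⋃ (t') (_ : t' ≠ t), entries (I t')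
    refine SameType.of_params (L := L) (C := f '' O) (z := x')
      (x := f ∘ fun q : Fin r × Fin (m t) => I t (i q.1) q.2)
      (x' := f ∘ fun q => I t (i' q.1) q.2) ?_ ?_ φ
    · refine (H O _ _).1 ?_
      by_cases ht : t = s
      · subst ht
        have h1 : ∀ᶠ j in Filter.atTop, ∀ a, i a < j :=
          Filter.eventually_all.2 fun a => Filter.eventually_gt_atTop _
        have h2 : ∀ᶠ j in Filter.atTop, ∀ a, i' a < j :=
          Filter.eventually_all.2 fun a => Filter.eventually_gt_atTop _
        filter_upwards [h1, h2] with j h1 h2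
        -- Once `j` exceeds the finitely many indices in play, placing the tail `h j` after them
        -- keeps the order, whether they are `i` or `i'`.
        have key : ∀ i : Fin r → J t, StrictMono i → (∀ a, i a < j) →
            StrictMono (fun k : Fin r ⊕ₗ ℕ => Sum.elim i (h j) (ofLex k)) := by
          intro i hi hij a b hab
          rcases a with a | a <;> rcases b with b | b
          · exact hi (Sum.Lex.inl_lt_inl_iff.1 hab)
          · exact (hij a).trans (hj j b)
          · exact absurd hab Sum.Lex.not_inr_lt_inl
          · exact hh j (Sum.Lex.inr_lt_inr_iff.1 hab)
        refine ((hI t).sameType univ ((key i hi h1).strictMonoOn _)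
          ((key i' hi' h2).strictMonoOn _)).transfer subset_rfl fun q => .inr ?_
        rcases q with q | q
        · exact ⟨(⟨toLex (.inr q.1), trivial⟩, q.2), rfl, rfl⟩
        · exact ⟨(⟨toLex (.inl q.1), trivial⟩, q.2), rfl, rfl⟩
      · refine Filter.Eventually.of_forall fun j => ?_
        refine SameType.to_params (D := O) (fun φ => hI t r φ i i' hi hi') subset_rfl ?_
        rintro _ ⟨q, rfl⟩
        exact .inr (mem_iUnion₂.2 ⟨s, Ne.symm ht, _, _, rfl⟩)
    · rintro b ((hb | hb) | hb)
      · exact .inl (image_mono subset_union_left hb)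
      · exact .inr hb
      · obtain ⟨t', ht', j, τ, rfl⟩ := mem_iUnion₂.1 hb
        exact .inl ⟨_, .inr (mem_iUnion₂.2 ⟨t', ht', j, τ, rfl⟩), rfl⟩
  · intro t ht
    by_cases hts : t = s
    · subst hts
      refine hs.mono (union_subset_union_right _ ?_)
      rintro b ⟨t', ht', hne, hb⟩
      exact ⟨t', ht'.resolve_left hne, hb⟩
    have htR : t ∈ R := ht.resolve_left hts
    intro r φ i i' hi hi'
    let O : Set N := D ∪ {b | ∃ t' ∈ R, t' ≠ t ∧ b ∈ entries (I t')}
    let y : (Fin r → J t) → Fin r × Fin (m t) → N := fun i q => I t (i q.1) q.2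
    refine SameType.of_params (L := L) (C := O) (z := fun q : J s × Fin (m s) => I s q.1 q.2)
      (x := y i) (x' := y i') ?_ ?_ φ
    · refine SameType.of_finite fun F φ => ?_
      by_contra hφ
      let G : Finset (J s) := F.toLeft.image Prod.fst
      obtain ⟨e, he⟩ := exists_strictMonoOn (J := ℕ) G
      let X : J s → (Fin r → J t) → F → N := fun j i q =>
        Sum.elim (fun p : J s × Fin (m s) => x j (e p.1, p.2)) (y i) q
      -- By `hs`, the finitely many members of `I s` used by `φ` can be replaced by members of `x j`
      -- without changing the type over the sequences in `R`. The failure thus holds for every `j`,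
      -- so it passes to the limit.
      have key : ∀ j i, SameType L O
          (fun q : F => Sum.elim (fun q : J s × Fin (m s) => I s q.1 q.2) (y i) q) (X j i) := by
        intro j i
        refine (hs.sameType (G : Set (J s)) (i := id) (i' := h j ∘ e)
          (strictMono_id.strictMonoOn _) ((hh j).comp_strictMonoOn he)).transfer
          (union_subset_union_right _ fun b ⟨t', ht', _, hb⟩ => ⟨t', ht', hb⟩) ?_
        rintro ⟨q | q, hq⟩
        · refine .inr ⟨(⟨q.1, ?_⟩, q.2), rfl, rfl⟩
          exact Finset.mem_coe.2 (Finset.mem_image_of_mem _ (Finset.mem_toLeft.2 hq))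
        · exact .inl ⟨.inr ⟨t, htR, _, _, rfl⟩, rfl⟩
      let ρ : F → (ℕ × Fin (m s)) ⊕ (Fin r × Fin (m t)) := fun q =>
        Sum.map (fun p : J s × Fin (m s) => (e p.1, p.2)) id q.1
      refine (H O (y i) (y i')).2 (φ.relabel (Sum.map id ρ)) (.of_forall fun j => ?_) ?_
      · have : ∀ i, (φ.relabel (Sum.map id ρ)).Realize
            (Sum.elim (fun c : O => (c : N)) (Sum.elim (x j) (y i))) ↔
              φ.Realize (Sum.elim (fun c : O => (c : N)) (X j i)) := by
          intro i
          rw [Formula.realize_relabel]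
          refine iff_of_eq (congrArg φ.Realize (funext fun q => ?_))
          rcases q with q | ⟨q | q, hq⟩ <;> rfl
        rw [this, this, ← key j i φ, ← key j i' φ]
        exact hφ
      · refine SameType.to_params (fun φ => hgood t htR r φ i i' hi hi') ?_ ?_
        · rintro _ ⟨b, hb | ⟨t', ht', hne, j, τ, rfl⟩, rfl⟩
          · exact .inl (.inr ⟨b, hb, rfl⟩)
          · exact .inr ⟨t', ht', hne, j, τ, rfl⟩
        · exact fun b hb => .inl (.inl (.inr hb))
    · rintro b (hb | ⟨t', ht', hne, hb⟩)
      · exact .inl (.inl hb)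
      · rcases ht' with rfl | ht'
        · obtain ⟨j, τ, rfl⟩ := hb
          exact .inr ⟨(j, τ), rfl⟩
        · exact .inl (.inr ⟨t', ht', hne, hb⟩)

end Limit

/-! ### Rank of a tuple and deletion of sequences -/

section Rank

open FirstOrder.Language

/-- Whenever `1 + k` infinite sequences in an elementary extension of `N` are mutually indiscernible
over a set `C`, one of them is indiscernible over `C` and the tuple `a`. -/
def TupleRankLE (L : FirstOrder.Language.{u, v}) {N : Type w} [L.Structure N] {n : ℕ}
    (a : Fin n → N) (k : ℕ) : Prop :=
  ∀ (N' : Type w) [L.Structure N'] (f : N ↪ₑ[L] N') (C : Set N') (J : Fin (1 + k) → Type w)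
    [∀ s, LinearOrder (J s)] [∀ s, Infinite (J s)] (m : Fin (1 + k) → ℕ)
    (I : ∀ s, J s → Fin (m s) → N'), MutuallyIndiscernible L C I →
      ∃ s, Indiscernible L (C ∪ range (f ∘ a)) (I s)

variable {L : FirstOrder.Language.{u, v}} {N : Type w} [L.Structure N]

theorem TupleRankLE.map {n k : ℕ} {a : Fin n → N} (h : TupleRankLE L a k) {N' : Type w}
    [L.Structure N'] (f : N ↪ₑ[L] N') : TupleRankLE L (f ∘ a) k :=
  fun N'' _ g => h N'' (g.comp f)

theorem Indiscernible.of_finite_params {C D : Set N} {J : Type w} [LinearOrder J] {m : ℕ}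
    {I : J → Fin m → N} (h : ∀ B : Finset N, (B : Set N) ⊆ C → Indiscernible L (B ∪ D) I) :
    Indiscernible L (C ∪ D) I := by
  classical
  intro r φ i i' hi hi'
  refine SameType.of_finite_params (L := L) (C := C ∪ D)
    (x := fun q : Fin r × Fin m => I (i q.1) q.2) (y := fun q => I (i' q.1) q.2) (fun B hB => ?_) φ
  refine SameType.mono (fun φ => h (B.filter (· ∈ C)) (by intro b; simp) r φ i i' hi hi') ?_
  intro b hb
  rcases hB hb with h | h
  · exact .inl (by simpa using ⟨hb, h⟩)
  · exact .inr h

/-- To bound the rank of a tuple it suffices to consider sequences that are mutually indiscernible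
over the empty set. -/
theorem tupleRankLE_of_empty {n k : ℕ} {a : Fin n → N}
    (h : ∀ (N' : Type w) [L.Structure N'] (f : N ↪ₑ[L] N') (J : Fin (1 + k) → Type w)
      [∀ s, LinearOrder (J s)] [∀ s, Infinite (J s)] (m : Fin (1 + k) → ℕ)
      (I : ∀ s, J s → Fin (m s) → N'), MutuallyIndiscernible L ∅ I →
        ∃ s, Indiscernible L (range (f ∘ a)) (I s)) : TupleRankLE L a k := by
  classical
  intro N' _ f C J _ _ m I hI
  by_contra! hcon
  have : ∀ s, ∃ B : Finset N', (B : Set N') ⊆ C ∧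
      ¬ Indiscernible L (B ∪ range (f ∘ a)) (I s) := by
    intro s
    by_contra! hs
    exact hcon s (Indiscernible.of_finite_params hs)
  choose B hBC hB using this
  let B' := Finset.univ.biUnion B
  have hB'C : (B' : Set N') ⊆ C := by
    intro b hb
    obtain ⟨s, -, hs⟩ := Finset.mem_biUnion.1 (Finset.mem_coe.1 hb)
    exact hBC s hs
  let b : Fin B'.card → N' := fun i => B'.equivFin.symm i
  have hbB : ∀ i, b i ∈ B' := fun i => (B'.equivFin.symm i).2
  have hmut : MutuallyIndiscernible L ∅ fun s j => Fin.append (I s j) b := by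
    intro s r φ i i' hi hi'
    refine SameType.transfer (L := L) (D := ∅ ∪ ⋃ (t) (_ : t ≠ s), entries _)
      (y := fun q : Fin r × Fin (m s + B'.card) => Fin.append (I s (i q.1)) b q.2)
      (y' := fun q => Fin.append (I s (i' q.1)) b q.2)
      (x := fun q : Fin r × Fin (m s) => I s (i q.1) q.2) (x' := fun q => I s (i' q.1) q.2)
      (fun φ => hI s r φ i i' hi hi') ?_ ?_ φ
    · rintro c (hc | hc)
      · exact hc.elim
      · obtain ⟨t, ht, j, τ, rfl⟩ := mem_iUnion₂.1 hc
        induction τ using Fin.addCases with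
        | left τ => exact .inr (mem_iUnion₂.2 ⟨t, ht, j, τ, by simp⟩)
        | right τ => exact .inl (hB'C (by simpa using hbB τ))
    · rintro ⟨p, τ⟩
      induction τ using Fin.addCases with
      | left τ => exact .inr ⟨(p, τ), by simp, by simp⟩
      | right τ => exact .inl ⟨.inl (hB'C (by simpa using hbB τ)), by simp⟩
  obtain ⟨s, hs⟩ := h N' f J (fun s => m s + B'.card) (fun s j => Fin.append (I s j) b) hmut
  refine hB s fun r φ i i' hi hi' => ?_
  refine SameType.of_params (L := L) (C := range (f ∘ a)) (z := b)
    (x := fun q : Fin r × Fin (m s) => I s (i q.1) q.2) (x' := fun q => I s (i' q.1) q.2)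
    ?_ ?_ φ
  -- For positive `r` the parameters `b` are read off the first tuple of the subsequence; for `r =
  -- 0` no tuple carries them, but then `i = i'`.
  · rcases r.eq_zero_or_pos with rfl | hr
    · have : i = i' := Subsingleton.elim _ _
      rw [this]
      exact SameType.refl _ _
    · refine SameType.transfer (L := L)
        (x := fun q : Fin r × Fin (m s + B'.card) => Fin.append (I s (i q.1)) b q.2)
        (x' := fun q => Fin.append (I s (i' q.1)) b q.2) (fun φ => hs r φ i i' hi hi')
        subset_rfl fun q => .inr ?_
      rcases q with q | q
      · exact ⟨(⟨0, hr⟩, Fin.natAdd _ q), by simp, by simp⟩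
      · exact ⟨(q.1, Fin.castAdd _ q.2), by simp, by simp⟩
  · refine union_subset (fun c hc => .inr ?_) subset_union_left
    have : c ∈ B' := Finset.mem_biUnion.2 ⟨s, Finset.mem_univ _, hc⟩
    exact ⟨B'.equivFin ⟨c, this⟩, by simp [b]⟩

/-- The sequences outside `E` are mutually indiscernible over `C` and the sequences in `E`; `1 + k`
of them, none staying indiscernible over `a`, would violate the rank bound over this base. -/
theorem MutuallyIndiscernible.ncard_le_of_not_indiscernible {n k : ℕ} {a : Fin n → N}
    (ha : TupleRankLE L a k) {S : Type} [Finite S] {J : S → Type w} [∀ s, LinearOrder (J s)]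
    [∀ s, Infinite (J s)] {m : S → ℕ} {C : Set N} {I : ∀ s, J s → Fin (m s) → N}
    (hI : MutuallyIndiscernible L C I) (E : Set S)
    (hE : ∀ s ∉ E, ¬ Indiscernible L (C ∪ range a ∪ {b | ∃ t ∈ E, b ∈ entries (I t)}) (I s)) :
    Eᶜ.ncard ≤ k := by
  classical
  by_contra! hk
  let D : Set N := C ∪ {b | ∃ t ∈ E, b ∈ entries (I t)}
  cases nonempty_fintype S
  have : Fintype.card (Fin (1 + k)) ≤ Fintype.card (Eᶜ : Set S) := by
    rw [Fintype.card_fin, ← Nat.card_eq_fintype_card, Nat.card_coe_set_eq]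
    omega
  obtain ⟨e⟩ := Function.Embedding.nonempty_of_card_le this
  have hmut : MutuallyIndiscernible L D fun s => I (e s) := by
    refine fun s => (hI (e s)).mono ?_
    rintro b ((hb | ⟨t, ht, hb⟩) | hb)
    · exact .inl hb
    · refine .inr (mem_iUnion₂.2 ⟨t, ?_, hb⟩)
      rintro rfl
      exact (e s).2 ht
    · obtain ⟨t, ht, hb⟩ := mem_iUnion₂.1 hb
      refine .inr (mem_iUnion₂.2 ⟨e t, ?_, hb⟩)
      exact fun h => ht (e.injective (Subtype.ext h))
  obtain ⟨s, hs⟩ := ha N (ElementaryEmbedding.refl L N) D _ _ _ hmut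
  refine hE (e s) (e s).2 (hs.mono ?_)
  rintro b ((hb | hb) | hb)
  · exact .inl (.inl hb)
  · exact .inr hb
  · exact .inl (.inr hb)

/-- Induction on a bound `g` for the number of good subfamilies, with `N`, `a`, `C` and `I` all
varying because each step passes to an extension. The case `g = 0` is impossible since `∅` is good.
-/
theorem MutuallyIndiscernible.exists_on_of_noMaxOrder {S : Type} [Finite S] {J : S → Type w}
    [∀ s, LinearOrder (J s)] [∀ s, Infinite (J s)] [∀ s, NoMaxOrder (J s)] {m : S → ℕ}
    {n k : ℕ} (g : ℕ) : ∀ {N : Type w} [L.Structure N] [Nonempty N] {a : Fin n → N}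
    (_ : TupleRankLE L a k) {C : Set N} {I : ∀ s, J s → Fin (m s) → N}
    (_ : MutuallyIndiscernible L C I)
    (_ : {E | MutuallyIndiscernibleOn L (C ∪ range a) I E}.ncard ≤ g),
    ∃ E : Set S, Eᶜ.ncard ≤ k ∧ MutuallyIndiscernibleOn L (C ∪ range a) I E := by
  induction g with
  | zero =>
    intro N _ _ a _ C I _ h
    rw [Nat.le_zero, Set.ncard_eq_zero] at h
    have : (∅ : Set S) ∈ {E | MutuallyIndiscernibleOn L (C ∪ range a) I E} := fun s hs => hs.elim
    rw [h] at this
    exact this.elim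
  | succ g ih =>
    intro N _ _ a ha C I hI h
    obtain ⟨E, hE⟩ := (Set.toFinite
      {E | MutuallyIndiscernibleOn L (C ∪ range a) I E}).exists_maximal ⟨∅, fun s hs => hs.elim⟩
    by_cases hcase : ∀ s ∉ E,
        ¬ Indiscernible L (C ∪ range a ∪ {b | ∃ t ∈ E, b ∈ entries (I t)}) (I s)
    · exact ⟨E, hI.ncard_le_of_not_indiscernible ha E hcase, hE.prop⟩
    · push Not at hcase
      obtain ⟨s, hsE, hs⟩ := hcase
      obtain ⟨N', _, f, C', hC', hI', hE'⟩ := hI.exists_limit_params hs fun hins =>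
        hsE (hE.le_of_ge hins (subset_insert s E) (mem_insert s E))
      have : Nonempty N' := ‹Nonempty N›.map f
      have hunion : C' ∪ range (f ∘ a) = C' ∪ f '' (C ∪ range a) := by
        rw [image_union, ← union_assoc, union_eq_self_of_subset_right hC', range_comp]
      have htrans : ∀ E'', MutuallyIndiscernibleOn L (C' ∪ range (f ∘ a))
          -- Enlarging the base creates no good subfamily, and it destroys `E`, so the count
          -- strictly drops.
          (fun s j t => f (I s j t)) E'' → MutuallyIndiscernibleOn L (C ∪ range a) I E'' :=
        fun E'' h => (mutuallyIndiscernibleOn_map_iff f).1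
          (h.mono (hunion ▸ subset_union_right) subset_rfl)
      obtain ⟨E'', hk, hE''⟩ := ih (ha.map f) hI' (by
        have := Set.ncard_lt_ncard (s := {E | MutuallyIndiscernibleOn L (C' ∪ range (f ∘ a))
          (fun s j t => f (I s j t)) E})
          (t := {E | MutuallyIndiscernibleOn L (C ∪ range a) I E})
          ⟨htrans, fun hsub => hE' (hunion ▸ hsub hE.prop)⟩
        omega)
      exact ⟨E'', hk, htrans _ hE''⟩

end Rank

/-! ### Subadditivity of the rank -/

section Subadditivity

open FirstOrder.Language

variable {L : FirstOrder.Language.{u, v}} {N : Type (max u v w)} [L.Structure N] [Nonempty N]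
  {S : Type} [Finite S] {J : S → Type (max u v w)} [∀ s, LinearOrder (J s)]
  [∀ s, Infinite (J s)] {m : S → ℕ}

/-- If `a` has rank at most `k`, then mutually indiscernible sequences remain mutually indiscernible
over `a` after the removal of at most `k` of them. -/
theorem MutuallyIndiscernible.exists_on {n k : ℕ} {a : Fin n → N} (ha : TupleRankLE L a k)
    {C : Set N} {I : ∀ s, J s → Fin (m s) → N} (hI : MutuallyIndiscernible L C I) :
    ∃ E : Set S, Eᶜ.ncard ≤ k ∧ MutuallyIndiscernibleOn L (C ∪ range a) I E := by
  -- The factor `ℕ` removes maximal elements, as the limit argument requires.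
  let J' : S → Type (max u v w) := fun s => J s ×ₗ ℕ
  let emb : ∀ s, J s ↪o J' s := fun s => OrderEmbedding.ofStrictMono (fun j => toLex (j, 0))
    fun j j' h => Prod.Lex.toLex_lt_toLex.2 (.inl h)
  obtain ⟨N', _, f, I', hI', hext⟩ := hI.exists_stretch.{u, v, w} emb
  have : Nonempty N' := ‹Nonempty N›.map f
  have : ∀ s, Infinite (J' s) := fun s => Infinite.of_injective _ (emb s).injective
  obtain ⟨E, hk, hE⟩ := MutuallyIndiscernible.exists_on_of_noMaxOrder _ (ha.map f) hI' le_rfl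
  refine ⟨E, hk, (mutuallyIndiscernibleOn_map_iff f).1 fun s hs => ?_⟩
  have h1 : (fun j t => f (I s j t)) = I' s ∘ emb s := by
    funext j t; exact (hext s j t).symm
  have h2 := ((hE s hs).comp (emb s).strictMono).mono (D :=
    f '' (C ∪ range a) ∪ {b | ∃ t ∈ E, t ≠ s ∧ b ∈ entries fun j τ => f (I t j τ)}) ?_
  · change Indiscernible L _ fun j t => f (I s j t)
    rw [h1]
    exact h2
  · rw [image_union, range_comp]
    refine union_subset_union_right _ ?_
    rintro _ ⟨t, ht, hts, j, τ, rfl⟩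
    exact ⟨t, ht, hts, emb t j, τ, hext t j τ⟩

/-- The rank of a tuple is at most the sum of the ranks of its coordinates. -/
theorem TupleRankLE.of_coordinates {n : ℕ} {a : Fin n → N} {k : Fin n → ℕ}
    (h : ∀ i, TupleRankLE L (fun _ : Fin 1 => a i) (k i)) : TupleRankLE L a (∑ i, k i) := by
  classical
  intro N' _ f C J _ _ m I hI
  have : Nonempty N' := ‹Nonempty N›.map f
  have key : ∀ T : Finset (Fin n), ∃ E : Set (Fin (1 + ∑ i, k i)), Eᶜ.ncard ≤ ∑ i ∈ T, k i ∧
      MutuallyIndiscernibleOn L (C ∪ (f ∘ a) '' T) I E := by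
    intro T
    induction T using Finset.induction_on with
    | empty => exact ⟨univ, by simp, by simpa using mutuallyIndiscernibleOn_univ.2 hI⟩
    | insert i T hi ih =>
      obtain ⟨E, hEk, hE⟩ := ih
      have hE' : MutuallyIndiscernible L (C ∪ (f ∘ a) '' T) fun s : E => I s := by
        rw [← mutuallyIndiscernibleOn_univ, mutuallyIndiscernibleOn_reindex
          Subtype.val_injective (I := I)]
        simpa using hE
      obtain ⟨E₁, hk₁, hE₁⟩ := hE'.exists_on ((h i).map f)
      rw [mutuallyIndiscernibleOn_reindex Subtype.val_injective (I := I)] at hE₁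
      refine ⟨Subtype.val '' E₁, ?_, hE₁.mono ?_ subset_rfl⟩
      · have hsub : (Subtype.val '' E₁ : Set (Fin (1 + ∑ i, k i)))ᶜ ⊆ Eᶜ ∪ Subtype.val '' E₁ᶜ := by
          intro s hs
          by_cases hsE : s ∈ E
          · exact .inr ⟨⟨s, hsE⟩, fun h => hs ⟨_, h, rfl⟩, rfl⟩
          · exact .inl hsE
        calc _ ≤ _ := Set.ncard_le_ncard hsub
          _ ≤ _ := Set.ncard_union_le _ _
          _ ≤ _ := by
            rw [Finset.sum_insert hi, Set.ncard_image_of_injective _ Subtype.val_injective]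
            omega
      · rintro b (hb | ⟨i', hi', rfl⟩)
        · exact .inl (.inl hb)
        · rcases Finset.mem_insert.1 (Finset.mem_coe.1 hi') with rfl | hi'
          · exact .inr ⟨0, rfl⟩
          · exact .inl (.inr ⟨i', hi', rfl⟩)
  obtain ⟨E, hk, hE⟩ := key Finset.univ
  -- There are `1 + ∑ i, k i` sequences and at most `∑ i, k i` were deleted.
  have : E.Nonempty := by
    rw [nonempty_iff_ne_empty]
    rintro rfl
    simp [Set.ncard_univ] at hk
  obtain ⟨s, hs⟩ := this
  rw [Finset.coe_univ, image_univ] at hE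
  exact ⟨s, (hE s hs).mono subset_union_left⟩

end Subadditivity

/-! ### Rank bounds alternation -/

section Alternation

open FirstOrder.Language

/-- A convex piece of an indiscernible sequence is indiscernible over the rest of the sequence. -/
theorem Indiscernible.ordConnected {L : FirstOrder.Language.{u, v}} {N : Type w} [L.Structure N]
    {C : Set N} {J : Type w} [LinearOrder J] {m : ℕ} {I : J → Fin m → N}
    (h : Indiscernible L C I) (Q : Set J) [Q.OrdConnected] :
    Indiscernible L (C ∪ {b | ∃ j ∉ Q, ∃ t, I j t = b}) (fun j : Q => I j) := by
  classical
  intro r φ i i' hi hi'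
  refine SameType.of_params (L := L) (C := C) (z := fun q : {j // j ∉ Q} × Fin m => I q.1 q.2)
    (x := fun q : Fin r × Fin m => I (i q.1) q.2) (x' := fun q => I (i' q.1) q.2) ?_ ?_ φ
  · let g : J → J := Function.extend (fun a => (i a : J)) (fun a => (i' a : J)) id
    have hinj : Function.Injective fun a => (i a : J) := Subtype.val_injective.comp hi.injective
    have hg : ∀ a, g (i a) = i' a := fun a => hinj.extend_apply _ _ a
    have hgQ : ∀ j ∉ Q, g j = j := fun j hj =>
      Function.extend_apply' _ _ _ fun ⟨a, ha⟩ => hj (ha ▸ (i a).2)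
    have key : ∀ j ∉ Q, ∀ p q : Q, j < p → j < q := fun j hj p q hjp => by
      by_contra! hq
      exact hj (Set.OrdConnected.out ‹_› q.2 p.2 ⟨hq, hjp.le⟩)
    have key' : ∀ j ∉ Q, ∀ p q : Q, (p : J) < j → (q : J) < j := fun j hj p q hjp => by
      by_contra! hq
      exact hj (Set.OrdConnected.out ‹_› p.2 q.2 ⟨hjp.le, hq⟩)
    have hmono : StrictMonoOn g (Qᶜ ∪ range fun a => (i a : J)) := by
      rintro j (hj | ⟨a, rfl⟩) j' (hj' | ⟨a', rfl⟩) hlt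
      · rwa [hgQ j hj, hgQ j' hj']
      · rw [hgQ j hj, hg]
        exact key j hj _ _ hlt
      · rw [hgQ j' hj', hg]
        exact key' j' hj' _ _ hlt
      · rw [hg, hg]
        exact hi' (hi.lt_iff_lt.1 hlt)
    refine (h.sameType _ (strictMono_id.strictMonoOn _) hmono).transfer subset_rfl fun q => .inr ?_
    rcases q with q | q
    · exact ⟨(⟨q.1, .inl q.1.2⟩, q.2), rfl, by simp [hgQ _ q.1.2]⟩
    · exact ⟨(⟨i q.1, .inr ⟨_, rfl⟩⟩, q.2), rfl, by simp [hg]⟩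
  · rintro b (hb | ⟨j, hj, t, rfl⟩)
    · exact .inl hb
    · exact .inr ⟨(⟨j, hj⟩, t), rfl⟩

theorem Indiscernible.realize_iff {L : FirstOrder.Language.{u, v}} {N : Type w} [L.Structure N]
    {J : Type w} [LinearOrder J] {n m : ℕ} {c : Fin n → N} {I : J → Fin m → N}
    (h : Indiscernible L (range c) I) (φ : L.Formula (Fin n ⊕ Fin m)) (j j' : J) :
    φ.Realize (Sum.elim c (I j)) ↔ φ.Realize (Sum.elim c (I j')) := by
  have := h 1 (φ.relabel (Sum.map (fun i => ⟨c i, i, rfl⟩) fun t => (0, t))) (fun _ => j)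
    (fun _ => j') (Subsingleton.strictMono _) (Subsingleton.strictMono _)
  rwa [Formula.realize_relabel, Formula.realize_relabel, Sum.elim_comp_map,
    Sum.elim_comp_map] at this

theorem HasAlternations.le_of_tupleRankLE {L : FirstOrder.Language.{u, v}}
    {N : Type (max u v w)} [L.Structure N] [Nonempty N] {J : Type (max u v w)} [LinearOrder J]
    [Infinite J] {n m k l : ℕ} {c : Fin n → N} (hc : TupleRankLE L c k) {I : J → Fin m → N}
    (hI : Indiscernible L ∅ I) {φ : L.Formula (Fin n ⊕ Fin m)} (h : HasAlternations φ c I l) :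
    l ≤ 2 * k := by
  by_contra! hl
  obtain ⟨i, hi, halt⟩ := h
  let emb : J ↪o J ×ₗ ℕ := OrderEmbedding.ofStrictMono (fun j => toLex (j, 0))
    fun j j' h => Prod.Lex.toLex_lt_toLex.2 (.inl h)
  have hMI : MutuallyIndiscernible L ∅ fun _ : Unit => I := fun s => by
    refine hI.mono ?_
    rintro b (hb | hb)
    · exact hb
    · obtain ⟨t, ht, -⟩ := mem_iUnion₂.1 hb
      exact (ht rfl).elim
  obtain ⟨N', _, f, I', hI', hext⟩ := hMI.exists_stretch.{u, v, w} fun _ => emb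
  have hI₁ : Indiscernible L ∅ (I' ()) := (hI' ()).mono (empty_subset _)
  -- The alternation points are grouped in disjoint consecutive pairs; the largest index used is `2k
  -- + 1`, available because `2k < l`.
  let lo : Fin (1 + k) → Fin (l + 1) := fun s => ⟨2 * s, by omega⟩
  let hi' : Fin (1 + k) → Fin (l + 1) := fun s => ⟨2 * s + 1, by omega⟩
  have hlt : ∀ s, i (lo s) < i (hi' s) := fun s => hi (Fin.mk_lt_mk.2 (by omega))
  let Q : Fin (1 + k) → Set (J ×ₗ ℕ) := fun s => Icc (emb (i (lo s))) (emb (i (hi' s)))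
  -- The interval may be finite in `J`; after stretching it contains the copy of `ℕ` above its left
  -- endpoint.
  have hinf : ∀ s, Infinite (Q s) := fun s => by
    refine Infinite.of_injective (fun p : ℕ => (⟨toLex (i (lo s), p), ?_, ?_⟩ : Q s)) ?_
    · exact Prod.Lex.toLex_le_toLex.2 (.inr ⟨rfl, Nat.zero_le _⟩)
    · exact Prod.Lex.toLex_le_toLex.2 (.inl (hlt s))
    · intro p q hpq
      exact (Prod.mk.inj (toLex.injective (Subtype.ext_iff.1 hpq))).2
  have hdisj : ∀ s t, s < t → ∀ x ∈ Q s, ∀ y ∈ Q t, x < y := fun s t hst x hx y hy =>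
    (hx.2.trans_lt (emb.strictMono (hi (Fin.mk_lt_mk.2 (by
      have : (s : ℕ) < t := hst
      omega))))).trans_le hy.1
  have hQ : MutuallyIndiscernible L ∅ fun s => fun j : Q s => I' () j := fun s => by
    have : (Q s).OrdConnected := ordConnected_Icc
    refine (hI₁.ordConnected (Q s)).mono (union_subset_union_right _ fun b hb => ?_)
    obtain ⟨t, ht, j, τ, rfl⟩ := mem_iUnion₂.1 hb
    refine ⟨j, fun hj => ?_, τ, rfl⟩
    rcases lt_or_gt_of_ne ht with h | h
    · exact lt_irrefl _ (hdisj t s h _ j.2 _ hj)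
    · exact lt_irrefl _ (hdisj s t h _ hj _ j.2)
  obtain ⟨s, hs⟩ := hc N' f ∅ _ _ _ hQ
  have := (hs.mono subset_union_right).realize_iff φ
    ⟨emb (i (lo s)), left_mem_Icc.2 (emb.monotone (hlt s).le)⟩
    ⟨emb (i (hi' s)), right_mem_Icc.2 (emb.monotone (hlt s).le)⟩
  have hmap : ∀ j, Sum.elim (f ∘ c) (I' () (emb j)) = f ∘ Sum.elim c (I j) := fun j => by
    funext q
    rcases q with q | q
    · rfl
    · exact hext () j q
  rw [hmap, hmap, f.map_formula, f.map_formula] at this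
  exact halt ⟨2 * s, by omega⟩ this

end Alternation

/-! ### From tuples back to types -/

section Types

open FirstOrder.Language

variable {L : FirstOrder.Language.{u, v}}

theorem tupleRankLE_of_realizes {M N : Type w} [L.Structure M] [L.Structure N] {n k : ℕ}
    {p : Set (L.Formula ((∅ : Set M) ⊕ Fin n))} (hp : DpRankLE p k) (f : M ↪ₑ[L] N)
    {a : Fin n → N} (ha : Realizes f p a) : TupleRankLE L a k := by
  refine tupleRankLE_of_empty fun N' _ g J _ _ m I hI => ?_
  have hga : Realizes (g.comp f) p (g ∘ a) := fun φ hφ => by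
    have := (g.map_formula φ _).2 (ha φ hφ)
    rwa [Sum.comp_elim] at this
  obtain ⟨s, hs⟩ := hp N' (g.comp f) (g ∘ a) hga J m I (by rwa [image_empty])
  exact ⟨s, hs.mono subset_union_right⟩

theorem isCompleteType_setOf_realize {N : Type w} [L.Structure N] {n : ℕ} (A : Set N)
    (a : Fin n → N) :
    IsCompleteType {φ : L.Formula (A ⊕ Fin n) | φ.Realize (Sum.elim (fun c : A => (c : N)) a)} :=
  ⟨fun _ hq => ⟨a, fun _ hφ => hq hφ⟩, fun φ => by
    simpa [Formula.realize_not] using em _⟩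

/-- Each tuple realizes its own complete type over `∅`, to which the hypothesis applies. -/
theorem TypesDpRankLE.tupleRankLE {T : L.Theory} {n k : ℕ} (h : TypesDpRankLE.{u, v, w} T n k)
    (N : Type (max u v w)) [L.Structure N] [Nonempty N] [N ⊨ T] (a : Fin n → N) :
    TupleRankLE L a k :=
  tupleRankLE_of_realizes (h (Theory.ModelType.of T N) _ (isCompleteType_setOf_realize ∅ a))
    (ElementaryEmbedding.refl L N) fun _ hφ => hφ

theorem TypesDpRankLE.altRank_le {T : L.Theory} {n k : ℕ} (h : TypesDpRankLE.{u, v, w} T n k)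
    {m : ℕ} (φ : L.Formula (Fin n ⊕ Fin m)) :
    altRank.{u, v, w} T φ ≤ ((2 * k : ℕ) : ℕ∞) := by
  refine sSup_le ?_
  rintro _ ⟨l, rfl, N, J, _, _, c, I, hI, hl⟩
  exact Nat.cast_le.2 (hl.le_of_tupleRankLE (h.tupleRankLE N c) hI)

/-- The restriction of a type to a single variable, over the empty set. -/
def restrictVar {M : Type w} {A : Set M} {n : ℕ} (p : Set (L.Formula (A ⊕ Fin n))) (i : Fin n) :
    Set (L.Formula ((∅ : Set M) ⊕ Fin 1)) :=
  {φ | φ.relabel (Sum.map (fun c => c.2.elim) fun _ => i) ∈ p}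

theorem IsCompleteType.restrictVar {M : Type w} [L.Structure M] {A : Set M} {n : ℕ}
    {p : Set (L.Formula (A ⊕ Fin n))} (hp : IsCompleteType p) (i : Fin n) :
    IsCompleteType (restrictVar p i) := by
  classical
  refine ⟨fun q hq => ?_, fun φ => hp.2 _⟩
  obtain ⟨a, ha⟩ := hp.1 (q.image fun φ => φ.relabel (Sum.map (fun c => c.2.elim) fun _ => i))
    (by
      intro ψ hψ
      obtain ⟨φ, hφ, rfl⟩ := Finset.mem_image.1 (Finset.mem_coe.1 hψ)
      exact hq hφ)
  refine ⟨fun _ => a i, fun φ hφ => ?_⟩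
  have := ha _ (Finset.mem_image_of_mem _ hφ)
  rw [Formula.realize_relabel] at this
  convert! this using 2
  funext b
  rcases b with b | b
  · exact b.2.elim
  · rfl

theorem Realizes.restrictVar {M N : Type w} [L.Structure M] [L.Structure N] {f : M ↪ₑ[L] N}
    {A : Set M} {n : ℕ} {p : Set (L.Formula (A ⊕ Fin n))} {a : Fin n → N} (ha : Realizes f p a)
    (i : Fin n) : Realizes f (restrictVar p i) fun _ => a i := by
  intro φ hφ
  have := ha _ hφ
  rw [Formula.realize_relabel] at this
  convert! this using 2
  funext b
  rcases b with b | b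
  · exact b.2.elim
  · rfl

theorem DpRankLE.of_coordinates {M : Type (max u v w)} [L.Structure M] [Nonempty M] {A : Set M}
    {n : ℕ} {p : Set (L.Formula (A ⊕ Fin n))} {k : Fin n → ℕ}
    (h : ∀ (N : Type (max u v w)) [L.Structure N] (f : M ↪ₑ[L] N) (a : Fin n → N),
      Realizes f p a → ∀ i, TupleRankLE L (fun _ : Fin 1 => a i) (k i)) :
    DpRankLE p (∑ i, k i) := by
  intro N _ f a ha J _ _ m I hI
  have : Nonempty N := ‹Nonempty M›.map f
  exact TupleRankLE.of_coordinates.{u, v, w} (h N f a ha) N (ElementaryEmbedding.refl L N) _ J m I hI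

/-- Elementary extensions of `M` are models of `T`, so each coordinate of a realization has rank at
most `k`, whatever `p` and its parameters are. -/
theorem TypesDpRankLE.dpRankLE {T : L.Theory} {k : ℕ} (h : TypesDpRankLE.{u, v, w} T 1 k)
    (M : Theory.ModelType.{u, v, max u v w} T) (A : Set M) (n : ℕ)
    (p : Set (L.Formula (A ⊕ Fin n))) : DpRankLE p (n * k) := by
  have : DpRankLE p (∑ _ : Fin n, k) := by
    refine DpRankLE.of_coordinates.{u, v, w} fun N _ f a _ i => ?_
    have : Nonempty N := M.nonempty'.map f
    have : N ⊨ T := (f.theory_model_iff T).1 M.is_model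
    exact h.tupleRankLE N _
  simpa using this

end Types

end DpRank

theorem mainTheorem7 {L : FirstOrder.Language.{u, v}} (T : L.Theory) :
    -- a bound on the rank of the types in the sort of `x` bounds the alternation rank
    (∀ n k : ℕ, DpRank.TypesDpRankLE.{u, v, w} T n k →
      ∀ (m : ℕ) (φ : L.Formula (Fin n ⊕ Fin m)),
        DpRank.altRank.{u, v, w} T φ ≤ ((2 * k + 1 : ℕ) : ℕ∞)) ∧
    -- if all one-variable types have finite dp-rank, so do all types
    ((∀ (M : FirstOrder.Language.Theory.ModelType.{u, v, max u v w} T)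
        (p : Set (L.Formula ((∅ : Set M) ⊕ Fin 1))), DpRank.IsCompleteType p →
          ∃ k : ℕ, DpRank.DpRankLE p k) →
      ∀ (M : FirstOrder.Language.Theory.ModelType.{u, v, max u v w} T) (A : Set M) (n : ℕ)
        (p : Set (L.Formula (A ⊕ Fin n))), DpRank.IsCompleteType p →
          ∃ k : ℕ, DpRank.DpRankLE p k) ∧
    -- the uniform version, with the global bound on alternation ranks
    (∀ k : ℕ, DpRank.TypesDpRankLE.{u, v, w} T 1 k →
      (∀ (M : FirstOrder.Language.Theory.ModelType.{u, v, max u v w} T) (A : Set M) (n : ℕ)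
        (p : Set (L.Formula (A ⊕ Fin n))), DpRank.IsPartialType p →
          DpRank.DpRankLE p (n * k)) ∧
      (∀ (n m : ℕ) (φ : L.Formula (Fin n ⊕ Fin m)),
        DpRank.altRank.{u, v, w} T φ ≤ ((2 * k * n + 1 : ℕ) : ℕ∞))) ∧
    -- the dp-minimal case
    (DpRank.IsDpMinimal.{u, v, w} T →
      ∀ (n m : ℕ) (φ : L.Formula (Fin n ⊕ Fin m)),
        DpRank.altRank.{u, v, w} T φ ≤ ((2 * n + 1 : ℕ) : ℕ∞)) := by
  have alt : ∀ k : ℕ, DpRank.TypesDpRankLE.{u, v, w} T 1 k → ∀ (n m : ℕ)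
      (φ : L.Formula (Fin n ⊕ Fin m)),
        DpRank.altRank.{u, v, w} T φ ≤ ((2 * k * n + 1 : ℕ) : ℕ∞) := by
    intro k h n m φ
    have hn : DpRank.TypesDpRankLE.{u, v, w} T n (n * k) := fun M p _ => h.dpRankLE M ∅ n p
    refine (hn.altRank_le φ).trans (Nat.cast_le.2 ?_)
    rw [mul_comm n k, mul_assoc]
    exact Nat.le_succ _
  refine ⟨fun n k h m φ => (h.altRank_le φ).trans (Nat.cast_le.2 (Nat.le_succ _)), ?_,
    fun k h => ⟨fun M A n p _ => h.dpRankLE M A n p, alt k h⟩, fun h n m φ => ?_⟩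
  · intro h M A n p hp
    -- Without a uniform bound, completeness of `p` is used: it determines the type over `∅` of each
    -- coordinate, so the `k i` do not depend on the realization.
    choose k hk using fun i => h M _ (hp.restrictVar i)
    exact ⟨_, DpRank.DpRankLE.of_coordinates.{u, v, w} fun N _ f a ha i =>
      DpRank.tupleRankLE_of_realizes (hk i) f (ha.restrictVar i)⟩
  · simpa using alt 1 h n m φ
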